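/- Let $(F_n)_{n\ge 1}$ be distribution functions of probability laws on $[0,1]$ with $F_n(0)=0$, and let $(\alpha_n)_{n\ge1}$ be positive real numbers with $0<\liminf_n\alpha_n\le\limsup_n\alpha_n<\infty$ such that (i) $\displaystyle\lim_{t\to0^+}\sup_n\left|\frac{F_n(t)}{t}-\alpha_n\right|=0$, and (ii) $\displaystyle\lim_{t\to0^+}\sup_n\int_0^t\frac1u\left|\frac{F_n(u)}{u}-\alpha_n\right|du=0.$ Assume that $\alpha_n\to\alpha\in\mathbb R$ as $n\to\infty$. Let $(U_n)_{n\ge1}$ be independent random variables, $U_n$ having distribution function $F_n$, and put $Y_n=1/U_n$. Let $\{a_{k,n}\}_{n\ge1,\,1\le k\le n}$ be an array of positive numbers such that $$\lim_{n\to\infty}\sum_{k=1}^n a_{k,n}=\kappa\in\mathbb R,\qquad \lim_{n\to\infty}\max_{1\le k\le n}a_{k,n}=0 .$$ Put $$c_{F_n}=1-\alpha_n\gamma+\int_0^1\frac1u\left(\frac{F_n(u)}{u}-\alpha_n\right)du,$$ where $\gamma$ is Euler's constant, and $$V_n=\sum_{k=1}^n a_{k,n}Y_k-\Big(\kappa+\sum_{k=1}^n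 a_{k,n}(c_{F_k}-1)\Big)+\sum_{k=1}^n\alpha_k a_{k,n}\log a_{k,n}.$$ Then the integrals defining the $c_{F_n}$ converge absolutely, and $V_n$ converges in law, as $n\to\infty$, to the probability law $\mu$ on $\mathbb R$ with characteristic function $$\xi(t)=\exp\left(-i t\,\alpha\kappa\log|t|-\frac{\pi\alpha\kappa|t|}{2}\right)\qquad(t\in\mathbb R),$$ where $t\log|t|$ is read as $0$ at $t=0$. -/

import Mathlib

open MeasureTheory ProbabilityTheory Filter Topology
open scoped ENNReal

/-! Sequences indexed by `n ≥ 1` in the mathematical text are indexed here from `0`: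
`F k`, `α k`, `U k` stand for the `(k+1)`-st terms.  For an array of weights, row `n` consists of
the `n` entries `a k n` with `k < n`; the values `a k n` with `n ≤ k` are never used. -/

/-- Condition (i): `F n t / t → α n` as `t → 0+`, uniformly in `n`, where the `α n` are positive
with `0 < liminf α n ≤ limsup α n < ∞`. The suprema and limits are taken in extended numbers. -/
structure UniformlyLinearAtZero (F : ℕ → ℝ → ℝ) (α : ℕ → ℝ) : Prop where
  pos : ∀ n, 0 < α n
  liminf_pos : 0 < liminf (fun n => ((α n : ℝ) : EReal)) atTop
  limsup_lt_top : limsup (fun n => ((α n : ℝ) : EReal)) atTop < ⊤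
  tendsto_zero :
    Tendsto (fun t : ℝ => ⨆ n, ENNReal.ofReal |F n t / t - α n|) (𝓝[>] 0) (𝓝 0)

/-- Condition (ii): the integrals over `(0, t)` of `u ↦ (1 / u) * |F n u / u - α n|` tend to `0`
as `t → 0+`, uniformly in `n`. -/
def UniformlyIntegrableAtZero (F : ℕ → ℝ → ℝ) (α : ℕ → ℝ) : Prop :=
  Tendsto
    (fun t : ℝ => ⨆ n, ∫⁻ u in Set.Ioo 0 t, ENNReal.ofReal (1 / u * |F n u / u - α n|))
    (𝓝[>] 0) (𝓝 0)

/-- The integrand `u ↦ (1 / u) * (F u / u - α)` of the constant `b_F`. -/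
noncomputable def bIntegrand (F : ℝ → ℝ) (α : ℝ) (u : ℝ) : ℝ := 1 / u * (F u / u - α)

/-- `c_F = 1 - α γ + b_F`, where `γ` is Euler's constant and
`b_F = ∫_0^1 (1 / u) * (F u / u - α) du`. -/
noncomputable def cConst (F : ℝ → ℝ) (α : ℝ) : ℝ :=
  1 - α * Real.eulerMascheroniConstant + ∫ u in (0 : ℝ)..1, bIntegrand F α u

/-- A triangular array of positive weights whose row sums converge to `κ` and whose row maxima
converge to `0`. -/
structure IsWeightArray (a : ℕ → ℕ → ℝ) (κ : ℝ) : Prop where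
  pos : ∀ n k, k < n → 0 < a k n
  tendsto_sum : Tendsto (fun n => ∑ k ∈ Finset.range n, a k n) atTop (𝓝 κ)
  tendsto_max : Tendsto (fun n => ⨆ k : Fin n, a k n) atTop (𝓝 0)

/-- The centred weighted sum
`V_n = ∑ a_{k,n} Y_k - (κ + ∑ a_{k,n} (c_{F_k} - 1)) + ∑ α_k a_{k,n} log a_{k,n}`. -/
noncomputable def centredSum {Ω : Type*} (a : ℕ → ℕ → ℝ) (κ : ℝ) (F : ℕ → ℝ → ℝ) (α : ℕ → ℝ)
    (Y : ℕ → Ω → ℝ) (n : ℕ) (ω : Ω) : ℝ :=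
  ∑ k ∈ Finset.range n, a k n * Y k ω
    - (κ + ∑ k ∈ Finset.range n, a k n * (cConst (F k) (α k) - 1))
    + ∑ k ∈ Finset.range n, α k * a k n * Real.log (a k n)

/-! Everything rests on a first-order expansion, uniform in `n`, of the Laplace transform of `Y =
1/U`: as `z → 0`, `E e^{-zY} = 1 - z (c_F - α log z) + o(|z|)`. Integration by parts turns `E
e^{-z/U}` into an integral of `F(u)/u²` against `z e^{-z/u}`. Splitting `F(u)/u² = α/u + b(u)`, the
first part gives the exponential integral `E₁(z) = -log z - γ + O(|z|)`, and the second gives `∫ b +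
o(1)`, uniformly by condition (ii) (`norm_integral_exp_neg_div_sub_one_add_le`). The expansion is
proved for `Re z > 0` and carried to the imaginary axis by continuity.

With `z = a_{k,n} w`, `w = -it`, let `ψ` be the characteristic-function factors. Since `|ψ - 1|² =
o(|z|)`, the product of the `ψ` may be replaced by `exp ∑ (ψ - 1)`. As `log (a w) = log a + log w`,
the centring cancels everything in the exponent but `w log w ∑ α_k a_{k,n} → α κ w log w`. Lévy's
continuity theorem concludes. -/

/-! ### The exponential integral near zero on the positive reals. -/

/-- The expression is the difference quotient at `0` of `s ↦ x ^ s * Γ(s + 1)`, and `Γ'(1) = -γ`. -/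
theorem tendsto_rpow_mul_Gamma_sub_inv {x : ℝ} (hx : 0 < x) :
    Tendsto (fun s : ℝ => x ^ s * Real.Gamma s - 1 / s) (𝓝[>] 0)
      (𝓝 (Real.log x - Real.eulerMascheroniConstant)) := by
  have h1 : HasDerivAt (fun s : ℝ => Real.Gamma (s + 1)) (-Real.eulerMascheroniConstant) 0 := by
    have h := Real.hasDerivAt_Gamma_one
    rw [← zero_add (1 : ℝ)] at h
    simpa using h.comp_add_const (0 : ℝ) 1
  have h2 : HasDerivAt (fun s : ℝ => x ^ s) (Real.log x) 0 := by
    simpa using (Real.hasStrictDerivAt_const_rpow hx 0).hasDerivAt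
  have h3 := h2.mul h1
  have h4 := (hasDerivAt_iff_tendsto_slope.1 h3).mono_left
    (nhdsWithin_mono 0 (fun y (hy : y ∈ Set.Ioi (0 : ℝ)) => hy.ne'))
  have e : Real.log x * Real.Gamma (0 + 1) + x ^ (0 : ℝ) * -Real.eulerMascheroniConstant
      = Real.log x - Real.eulerMascheroniConstant := by simp; ring
  rw [e] at h4
  refine h4.congr' ?_
  filter_upwards [self_mem_nhdsWithin] with s hs
  have hs0 : s ≠ 0 := (Set.mem_Ioi.1 hs).ne'
  simp only [slope_def_field, Pi.mul_apply, Real.Gamma_add_one hs0]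
  simp
  field_simp

theorem integrableOn_rpow_mul_exp_neg_mul {s r : ℝ} (hs : 0 < s) (hr : 0 < r) :
    IntegrableOn (fun t : ℝ => t ^ (s - 1) * Real.exp (-(r * t))) (Set.Ioi 0) := by
  have h := integrableOn_rpow_mul_exp_neg_mul_rpow (s := s - 1) (p := 1) (by linarith) one_pos hr
  simpa using h

theorem tendsto_integral_rpow_mul_exp_neg_mul {r : ℝ} (hr : 0 < r) :
    Tendsto (fun s : ℝ => ∫ t in Set.Ioi (1 : ℝ), t ^ (s - 1) * Real.exp (-(r * t))) (𝓝[>] 0)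
      (𝓝 (∫ t in Set.Ioi (1 : ℝ), t ^ (-1 : ℝ) * Real.exp (-(r * t)))) := by
  refine tendsto_integral_filter_of_dominated_convergence (fun t => Real.exp (-(r * t))) ?_ ?_ ?_ ?_
  · exact Eventually.of_forall fun s => (by fun_prop : Measurable _).aestronglyMeasurable
  · have : Set.Ioo (0 : ℝ) 1 ∈ 𝓝[>] (0 : ℝ) := Ioo_mem_nhdsGT one_pos
    filter_upwards [this] with s hs
    filter_upwards [ae_restrict_mem measurableSet_Ioi] with t ht
    have ht1 : (1 : ℝ) < t := ht
    have : t ^ (s - 1) ≤ 1 := Real.rpow_le_one_of_one_le_of_nonpos ht1.le (by linarith [hs.2])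
    rw [Real.norm_eq_abs, abs_of_nonneg (by positivity)]
    nlinarith [Real.exp_pos (-(r * t))]
  · have := integrableOn_exp_mul_Ioi (neg_lt_zero.2 hr) 1
    simpa [neg_mul, IntegrableOn] using this
  · filter_upwards [ae_restrict_mem measurableSet_Ioi] with t ht
    have ht1 : (1 : ℝ) < t := ht
    refine Tendsto.mul_const _ ?_
    have : Continuous fun s : ℝ => t ^ (s - 1) := by
      have : t ≠ 0 := by linarith
      exact Continuous.rpow continuous_const (by fun_prop) (fun _ => Or.inl this)
    have h := this.tendsto 0
    simp only [zero_sub] at h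
    exact h.mono_left nhdsWithin_le_nhds

/-- Cut the Gamma integral at `1`. Since `1 / s` is the integral of `t ^ (s - 1)` over `(0, 1]`,
what remains is that of `t ^ (s - 1) * (e^{-rt} - 1)`, of modulus at most `r t ^ s ≤ r`. The bound
is free of `s`, so it survives `s → 0+`. -/
theorem abs_rpow_mul_Gamma_sub_inv_sub_integral_le {r s : ℝ} (hr : 0 < r) (hs : 0 < s) :
    |(1 / r) ^ s * Real.Gamma s - 1 / s
      - ∫ t in Set.Ioi (1 : ℝ), t ^ (s - 1) * Real.exp (-(r * t))| ≤ r := by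
  have hint := integrableOn_rpow_mul_exp_neg_mul hs hr
  have hsplit : Set.Ioi (0 : ℝ) = Set.Ioc 0 1 ∪ Set.Ioi 1 :=
    (Set.Ioc_union_Ioi_eq_Ioi zero_le_one).symm
  have hint1 := hint.mono_set (show Set.Ioc (0 : ℝ) 1 ⊆ Set.Ioi 0 from fun x hx => hx.1)
  have hint2 := hint.mono_set (show Set.Ioi (1 : ℝ) ⊆ Set.Ioi 0 from
    fun x hx => (zero_lt_one.trans hx : (0 : ℝ) < x))
  have h := Real.integral_rpow_mul_exp_neg_mul_Ioi hs hr
  rw [hsplit, setIntegral_union (Set.Ioc_disjoint_Ioi le_rfl) measurableSet_Ioi hint1 hint2] at h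
  have hpow : ∫ t in Set.Ioc (0 : ℝ) 1, t ^ (s - 1) = 1 / s := by
    rw [← intervalIntegral.integral_of_le zero_le_one, integral_rpow (Or.inl (by linarith))]
    simp [hs.ne']
  have hpint : IntegrableOn (fun t : ℝ => t ^ (s - 1)) (Set.Ioc 0 1) := by
    rw [← intervalIntegrable_iff_integrableOn_Ioc_of_le zero_le_one]
    exact intervalIntegral.intervalIntegrable_rpow' (by linarith)
  have e : (1 / r) ^ s * Real.Gamma s - 1 / s
      - ∫ t in Set.Ioi (1 : ℝ), t ^ (s - 1) * Real.exp (-(r * t))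
      = ∫ t in Set.Ioc (0 : ℝ) 1, (t ^ (s - 1) * Real.exp (-(r * t)) - t ^ (s - 1)) := by
    rw [integral_sub hint1 hpint, hpow, ← h]; ring
  rw [e]
  have hb : ∀ t ∈ Set.Ioc (0 : ℝ) 1,
      ‖t ^ (s - 1) * Real.exp (-(r * t)) - t ^ (s - 1)‖ ≤ r := by
    intro t ht
    have h1 : 0 < t ^ (s - 1) := Real.rpow_pos_of_pos ht.1 _
    have h2 : Real.exp (-(r * t)) ≤ 1 := Real.exp_le_one_iff.2 (by nlinarith [ht.1])
    have h3 : 1 - r * t ≤ Real.exp (-(r * t)) := by linarith [Real.add_one_le_exp (-(r * t))]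
    have h4 : t ^ (s - 1) * t ≤ 1 := by
      have : t ^ (s - 1) * t = t ^ s := by
        rw [Real.rpow_sub_one ht.1.ne']; field_simp [ht.1.ne']
      rw [this]; exact Real.rpow_le_one ht.1.le ht.2 hs.le
    rw [Real.norm_eq_abs, abs_le]
    constructor
    · nlinarith [mul_le_mul_of_nonneg_left h3 h1.le, mul_le_mul_of_nonneg_left h4 hr.le]
    · nlinarith
  have := norm_setIntegral_le_of_norm_le_const (μ := volume) (by simp) hb
  simpa using this

/-- Substitution `t = 1 / u`, which needs no integrability and hence no sign of `r`. -/
theorem integral_exp_neg_div_div {r : ℝ} :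
    ∫ u in Set.Ioc (0 : ℝ) 1, Real.exp (-(r / u)) / u
      = ∫ t in Set.Ioi (1 : ℝ), t ^ (-1 : ℝ) * Real.exp (-(r * t)) := by
  have h := integral_comp_rpow_Ioi
    (Set.indicator (Set.Ici (1 : ℝ)) (fun t => t ^ (-1 : ℝ) * Real.exp (-(r * t))))
    (p := -1) (by norm_num)
  rw [setIntegral_indicator measurableSet_Ici,
    show Set.Ioi (0 : ℝ) ∩ Set.Ici 1 = Set.Ici 1 from
      Set.inter_eq_right.2 fun x hx => (zero_lt_one.trans_le hx : (0 : ℝ) < x), integral_Ici_eq_integral_Ioi] at h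
  rw [← h, ← Set.Ioi_inter_Iic, ← setIntegral_indicator measurableSet_Iic]
  refine setIntegral_congr_fun measurableSet_Ioi fun u hu => ?_
  have hu0 : (0 : ℝ) < u := hu
  by_cases h1 : u ≤ 1
  · have h2 : u ^ (-1 : ℝ) ∈ Set.Ici (1 : ℝ) := by
      rw [Real.rpow_neg_one]; exact (one_le_inv₀ hu0).2 h1
    simp only [Set.indicator_of_mem (show u ∈ Set.Iic (1 : ℝ) from h1), Set.indicator_of_mem h2]
    rw [Real.rpow_neg_one, Real.rpow_neg_one, inv_inv, Real.rpow_sub hu0]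
    simp
    rw [Real.rpow_neg_one]
    field_simp
  · have h2 : u ^ (-1 : ℝ) ∉ Set.Ici (1 : ℝ) := by
      rw [Real.rpow_neg_one, Set.mem_Ici, one_le_inv₀ hu0]; exact h1
    simp only [Set.indicator_of_notMem (show u ∉ Set.Iic (1 : ℝ) from h1),
      Set.indicator_of_notMem h2, smul_zero]

theorem abs_integral_exp_neg_div_div_add_log_le {r : ℝ} (hr : 0 < r) :
    |(∫ u in Set.Ioc (0 : ℝ) 1, Real.exp (-(r / u)) / u) + Real.log r
      + Real.eulerMascheroniConstant| ≤ r := by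
  have h := ((tendsto_rpow_mul_Gamma_sub_inv (one_div_pos.2 hr)).sub
    (tendsto_integral_rpow_mul_exp_neg_mul hr)).abs
  have := le_of_tendsto h (b := r) (by
    filter_upwards [self_mem_nhdsWithin] with s hs
    exact abs_rpow_mul_Gamma_sub_inv_sub_integral_le hr hs)
  rw [one_div, Real.log_inv] at this
  rw [integral_exp_neg_div_div, ← abs_neg]
  refine le_of_eq_of_le ?_ this
  congr 1
  ring

/-! ### The exponential integral in the right half-plane. -/

/-- The Laplace transform `z ↦ ∫_0^1 e^{-z/u} u⁻¹ du = ∫_1^∞ e^{-zy} y⁻¹ dy`. -/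
noncomputable def expIntegralKernel (z : ℂ) : ℂ :=
  ∫ u in Set.Ioc (0 : ℝ) 1, Complex.exp (-(z / u)) / u

theorem norm_exp_neg_div (z : ℂ) (u : ℝ) :
    ‖Complex.exp (-(z / u))‖ = Real.exp (-(z.re / u)) := by
  rw [Complex.norm_exp, Complex.neg_re, Complex.div_ofReal_re]

/-- From `x² / 2 ≤ e^x` at `x = c / u`. Uniformity over `Re z ≥ c` makes this a dominating function
for differentiation in `z`. -/
theorem norm_exp_neg_div_div_sq_le {c : ℝ} (hc : 0 < c) {z : ℂ} (hz : c ≤ z.re) {u : ℝ}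
    (hu : 0 < u) : ‖Complex.exp (-(z / u)) / (u : ℂ) ^ 2‖ ≤ 2 / c ^ 2 := by
  rw [norm_div, norm_exp_neg_div, norm_pow, Complex.norm_real, Real.norm_eq_abs, abs_of_pos hu]
  have h1 : Real.exp (-(z.re / u)) ≤ Real.exp (-(c / u)) := by
    apply Real.exp_le_exp.2; gcongr
  have h2 := Real.quadratic_le_exp_of_nonneg (show 0 ≤ c / u by positivity)
  have h3 : (c / u) ^ 2 / 2 ≤ Real.exp (c / u) := by
    have : 0 < c / u := by positivity
    linarith
  refine (div_le_div_of_nonneg_right h1 (by positivity)).trans ?_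
  rw [Real.exp_neg, div_le_div_iff₀ (by positivity) (by positivity), inv_mul_le_iff₀ (by positivity)]
  rw [div_pow, div_div, div_le_iff₀ (by positivity)] at h3
  linarith

theorem norm_exp_neg_div_div_le {c : ℝ} (hc : 0 < c) {z : ℂ} (hz : c ≤ z.re) {u : ℝ}
    (hu : u ∈ Set.Ioc (0 : ℝ) 1) : ‖Complex.exp (-(z / u)) / (u : ℂ)‖ ≤ 2 / c ^ 2 := by
  have h := norm_exp_neg_div_div_sq_le hc hz hu.1
  have h0 : (u : ℂ) ≠ 0 := by exact_mod_cast hu.1.ne'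
  have : Complex.exp (-(z / u)) / (u : ℂ) = Complex.exp (-(z / u)) / (u : ℂ) ^ 2 * u := by
    field_simp
  rw [this, norm_mul, Complex.norm_real, Real.norm_eq_abs, abs_of_pos hu.1]
  exact (mul_le_of_le_one_right (norm_nonneg _) hu.2).trans h

theorem integrableOn_exp_neg_div_div_sq {z : ℂ} (hz : 0 < z.re) :
    IntegrableOn (fun u : ℝ => Complex.exp (-(z / u)) / (u : ℂ) ^ 2) (Set.Ioc 0 1) := by
  refine Measure.integrableOn_of_bounded (M := 2 / z.re ^ 2) (by simp)
    (by fun_prop : Measurable _).aestronglyMeasurable ?_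
  filter_upwards [ae_restrict_mem measurableSet_Ioc] with u hu
  exact norm_exp_neg_div_div_sq_le hz le_rfl hu.1

theorem integrableOn_exp_neg_div_div {z : ℂ} (hz : 0 < z.re) :
    IntegrableOn (fun u : ℝ => Complex.exp (-(z / u)) / (u : ℂ)) (Set.Ioc 0 1) := by
  refine Measure.integrableOn_of_bounded (M := 2 / z.re ^ 2) (by simp)
    (by fun_prop : Measurable _).aestronglyMeasurable ?_
  filter_upwards [ae_restrict_mem measurableSet_Ioc] with u hu
  exact norm_exp_neg_div_div_le hz le_rfl hu

theorem hasDerivAt_exp_neg_div (z : ℂ) {u : ℝ} (hu : 0 < u) :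
    HasDerivAt (fun u : ℝ => Complex.exp (-(z / u)))
      (z * (Complex.exp (-(z / u)) / (u : ℂ) ^ 2)) u := by
  have h0 : (u : ℂ) ≠ 0 := by exact_mod_cast hu.ne'
  have h1 : HasDerivAt (fun u : ℂ => Complex.exp (-(z / u)))
      (z * (Complex.exp (-(z / u)) / (u : ℂ) ^ 2)) (u : ℂ) := by
    have h2 := ((hasDerivAt_inv h0).const_mul z).neg.cexp
    simp only [← div_eq_mul_inv] at h2
    refine h2.congr_deriv ?_
    simp only [Pi.neg_apply]
    field_simp
  exact h1.comp_ofReal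

theorem integral_mul_exp_neg_div_div_sq_Ioc {z : ℂ} {x : ℝ} (hx : 0 < x) (hx1 : x ≤ 1) :
    ∫ u in Set.Ioc x 1, z * (Complex.exp (-(z / u)) / (u : ℂ) ^ 2)
      = Complex.exp (-z) - Complex.exp (-(z / x)) := by
  rw [← intervalIntegral.integral_of_le hx1,
    intervalIntegral.integral_eq_sub_of_hasDerivAt
      (f := fun u : ℝ => Complex.exp (-(z / u)))]
  · simp
  · intro u hu
    rw [Set.uIcc_of_le hx1] at hu
    exact hasDerivAt_exp_neg_div z (hx.trans_le hu.1)
  · apply ContinuousOn.intervalIntegrable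
    rw [Set.uIcc_of_le hx1]
    have : ∀ u ∈ Set.Icc x 1, (u : ℂ) ≠ 0 := fun u hu => by
      exact_mod_cast (hx.trans_le hu.1).ne'
    have h2 : ∀ u ∈ Set.Icc x 1, (u : ℂ) ^ 2 ≠ 0 := fun u hu => pow_ne_zero _ (this u hu)
    fun_prop (disch := assumption)

theorem integral_mul_exp_neg_div_div_sq {z : ℂ} (hz : 0 < z.re) :
    ∫ u in Set.Ioc (0 : ℝ) 1, z * (Complex.exp (-(z / u)) / (u : ℂ) ^ 2) = Complex.exp (-z) := by
  rw [← intervalIntegral.integral_of_le zero_le_one,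
    intervalIntegral.integral_eq_sub_of_hasDerivAt_of_tendsto (fa := 0) (fb := Complex.exp (-z))
      (f := fun u : ℝ => Complex.exp (-(z / u))) one_pos
      (fun u hu => hasDerivAt_exp_neg_div z hu.1)]
  · simp
  · rw [intervalIntegrable_iff_integrableOn_Ioc_of_le zero_le_one]
    exact (integrableOn_exp_neg_div_div_sq hz).const_mul z
  · rw [tendsto_zero_iff_norm_tendsto_zero]
    refine Tendsto.congr (fun u => (norm_exp_neg_div z u).symm) ?_
    have h : Tendsto (fun u : ℝ => z.re / u) (𝓝[>] 0) atTop :=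
      tendsto_inv_nhdsGT_zero.const_mul_atTop hz
    exact Real.tendsto_exp_neg_atTop_nhds_zero.comp h
  · have h := (hasDerivAt_exp_neg_div z one_pos).continuousAt.tendsto
    simp only [Complex.ofReal_one, div_one] at h
    exact h.mono_left nhdsWithin_le_nhds

theorem hasDerivAt_expIntegralKernel {z : ℂ} (hz : 0 < z.re) :
    HasDerivAt expIntegralKernel (-(Complex.exp (-z) / z)) z := by
  have hz0 : z ≠ 0 := by rintro rfl; simp at hz
  have hs : {w : ℂ | z.re / 2 < w.re} ∈ 𝓝 z :=
    (isOpen_lt continuous_const Complex.continuous_re).mem_nhds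
      (show z.re / 2 < z.re by linarith)
  have h := hasDerivAt_integral_of_dominated_loc_of_deriv_le
    (μ := volume.restrict (Set.Ioc (0 : ℝ) 1))
    (F := fun (w : ℂ) (u : ℝ) => Complex.exp (-(w / u)) / (u : ℂ))
    (F' := fun (w : ℂ) (u : ℝ) => -(Complex.exp (-(w / u)) / (u : ℂ) ^ 2))
    (bound := fun _ => 2 / (z.re / 2) ^ 2) hs
    (Eventually.of_forall fun w => (by fun_prop : Measurable _).aestronglyMeasurable)
    (integrableOn_exp_neg_div_div hz)
    (by fun_prop : Measurable _).aestronglyMeasurable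
    (by
      filter_upwards [ae_restrict_mem measurableSet_Ioc] with u hu w hw
      rw [norm_neg]
      exact norm_exp_neg_div_div_sq_le (by positivity) (le_of_lt hw) hu.1)
    (integrable_const _)
    (by
      filter_upwards [ae_restrict_mem measurableSet_Ioc] with u hu w hw
      have h2 := (((hasDerivAt_id w).div_const (u : ℂ)).neg.cexp).div_const (u : ℂ)
      refine h2.congr_deriv ?_
      simp only [id, Pi.neg_apply]
      ring)
  refine h.2.congr_deriv ?_
  rw [integral_neg, neg_inj, eq_div_iff hz0, mul_comm, ← integral_mul_exp_neg_div_div_sq hz,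
    integral_const_mul]

theorem expIntegralKernel_ofReal (r : ℝ) :
    expIntegralKernel r = ((∫ u in Set.Ioc (0 : ℝ) 1, Real.exp (-(r / u)) / u : ℝ) : ℂ) := by
  rw [expIntegralKernel, ← integral_complex_ofReal]
  simp

/-- The derivative of `E₁ + log` is `(1 - e^{-w}) / w`, bounded by `2` on the convex half-disc. The
mean value inequality compares `z` with a small real `r`, where the real estimate applies; then `r →
0+`. -/
theorem norm_expIntegralKernel_add_log_le {z : ℂ} (hz : 0 < z.re) (hz1 : ‖z‖ ≤ 1) :
    ‖expIntegralKernel z + Complex.log z + Real.eulerMascheroniConstant‖ ≤ 2 * ‖z‖ := by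
  set s : Set ℂ := {w : ℂ | 0 < w.re} ∩ Metric.closedBall 0 1
  have hs : Convex ℝ s := (convex_halfSpace_re_gt 0).inter (convex_closedBall 0 1)
  have hd : ∀ w ∈ s, HasDerivWithinAt (fun w => expIntegralKernel w + Complex.log w)
      (-(Complex.exp (-w) / w) + w⁻¹) s w := fun w hw =>
    ((hasDerivAt_expIntegralKernel hw.1).add (Complex.hasDerivAt_log (Or.inl hw.1))).hasDerivWithinAt
  have hb : ∀ w ∈ s, ‖-(Complex.exp (-w) / w) + w⁻¹‖ ≤ 2 := by
    intro w hw
    have hw0 : w ≠ 0 := by rintro rfl; simpa using hw.1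
    have e : -(Complex.exp (-w) / w) + w⁻¹ = -((Complex.exp (-w) - 1) / w) := by
      field_simp; ring
    have h1 : ‖-w‖ ≤ 1 := by simpa using hw.2
    have h2 := Complex.norm_exp_sub_one_le h1
    rw [norm_neg] at h2
    rw [e, norm_neg, norm_div]
    exact div_le_of_le_mul₀ (norm_nonneg _) (by norm_num) h2
  have key : ∀ r ∈ Set.Ioc (0 : ℝ) 1,
      ‖expIntegralKernel z + Complex.log z + Real.eulerMascheroniConstant‖ ≤
        2 * ‖z - (r : ℂ)‖ + r := by
    intro r hr
    have hrs : (r : ℂ) ∈ s :=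
      ⟨by simpa using hr.1, by simpa [abs_of_pos hr.1] using hr.2⟩
    have hzs : z ∈ s := ⟨hz, by simpa using hz1⟩
    have h1 := hs.norm_image_sub_le_of_norm_hasDerivWithin_le hd hb hrs hzs
    have h2 := abs_integral_exp_neg_div_div_add_log_le hr.1
    have h3 : ‖expIntegralKernel r + Complex.log r + Real.eulerMascheroniConstant‖ ≤ r := by
      rw [expIntegralKernel_ofReal, ← Complex.ofReal_log hr.1.le, ← Complex.ofReal_add,
        ← Complex.ofReal_add, Complex.norm_real]
      exact h2
    calc _ = ‖(expIntegralKernel z + Complex.log z - (expIntegralKernel r + Complex.log r))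
            + (expIntegralKernel r + Complex.log r + Real.eulerMascheroniConstant)‖ := by
          congr 1; ring
      _ ≤ _ := (norm_add_le _ _).trans (add_le_add h1 h3)
  have hlim : Tendsto (fun r : ℝ => 2 * ‖z - (r : ℂ)‖ + r) (𝓝[>] 0) (𝓝 (2 * ‖z‖)) := by
    have : Continuous fun r : ℝ => 2 * ‖z - (r : ℂ)‖ + r := by fun_prop
    have h := this.tendsto 0
    simp only [Complex.ofReal_zero, sub_zero, add_zero] at h
    exact h.mono_left nhdsWithin_le_nhds
  refine ge_of_tendsto hlim ?_
  filter_upwards [Ioc_mem_nhdsGT one_pos] with r hr using key r hr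

/-! ### Expansion of the Laplace transform of `1 / U` for a single law. -/

theorem cdf_nonneg_le_one {F : ℝ → ℝ} (hmono : Monotone F) (hF0 : F 0 = 0) (hF1 : F 1 = 1)
    {u : ℝ} (hu : u ∈ Set.Ioc (0 : ℝ) 1) : 0 ≤ F u ∧ F u ≤ 1 :=
  ⟨hF0 ▸ hmono hu.1.le, hF1 ▸ hmono hu.2⟩

theorem measurable_bIntegrand {F : ℝ → ℝ} (hmono : Monotone F) (α : ℝ) :
    Measurable (bIntegrand F α) := by
  have := hmono.measurable
  unfold bIntegrand
  fun_prop

theorem abs_bIntegrand {F : ℝ → ℝ} (α : ℝ) {u : ℝ} (hu : 0 < u) :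
    |bIntegrand F α u| = 1 / u * |F u / u - α| := by
  rw [bIntegrand, abs_mul, abs_of_pos (by positivity)]

theorem abs_bIntegrand_le {F : ℝ → ℝ} (hmono : Monotone F) (hF0 : F 0 = 0) (hF1 : F 1 = 1)
    {α A : ℝ} (hα : 0 < α) (hA : α ≤ A) {δ u : ℝ} (hδ : 0 < δ) (hu : δ ≤ u) (hu1 : u ≤ 1) :
    |bIntegrand F α u| ≤ 1 / δ * (1 / δ + A) := by
  have hu0 : 0 < u := hδ.trans_le hu
  obtain ⟨h0, h1⟩ := cdf_nonneg_le_one hmono hF0 hF1 ⟨hu0, hu1⟩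
  rw [abs_bIntegrand α hu0]
  have h2 : 1 / u ≤ 1 / δ := one_div_le_one_div_of_le hδ hu
  have h3 : F u / u ≤ 1 / δ := (div_le_div_of_nonneg_right h1 hu0.le).trans h2
  have h4 : 0 ≤ F u / u := by positivity
  have h5 : |F u / u - α| ≤ 1 / δ + A := by
    have : 0 < 1 / δ := by positivity
    rw [abs_le]; constructor <;> linarith
  gcongr

/-- For `U` with values in `(0, 1]`, an integration by parts: the Laplace transform of `1 / U` in
terms of the distribution function of `U`. -/
theorem integral_exp_neg_div_eq {Ω : Type*} [MeasurableSpace Ω] (P : Measure Ω)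
    [IsProbabilityMeasure P] {U : Ω → ℝ} (hU : Measurable U)
    (hpos : ∀ᵐ ω ∂P, U ω ∈ Set.Ioc (0 : ℝ) 1) {z : ℂ} (hz : 0 < z.re) :
    ∫ ω, Complex.exp (-(z / U ω)) ∂P = Complex.exp (-z)
      - ∫ u in Set.Ioc (0 : ℝ) 1,
          (P.real {ω | U ω ≤ u} : ℂ) * (z * (Complex.exp (-(z / u)) / (u : ℂ) ^ 2)) := by
  set h : ℝ → ℂ := fun u => z * (Complex.exp (-(z / u)) / (u : ℂ) ^ 2) with hh
  have hint : Integrable h (volume.restrict (Set.Ioc (0 : ℝ) 1)) :=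
    (integrableOn_exp_neg_div_div_sq hz).const_mul z
  -- `e^{-z} - e^{-z/U}` is the integral of `h` over `[U, 1]`, so the formula is Fubini for `h` on
  -- the region `U ≤ u`.
  set S : Set (Ω × ℝ) := {p | U p.1 ≤ p.2}
  have hS : MeasurableSet S := measurableSet_le (by fun_prop) (by fun_prop)
  have hprod : Integrable (S.indicator fun p : Ω × ℝ => h p.2)
      (P.prod (volume.restrict (Set.Ioc (0 : ℝ) 1))) :=
    (hint.comp_snd P).indicator hS
  have hswap := integral_integral_swap
    (f := fun (ω : Ω) (u : ℝ) => S.indicator (fun p : Ω × ℝ => h p.2) (ω, u)) hprod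
  have e1 : ∀ u, ∫ ω, S.indicator (fun p : Ω × ℝ => h p.2) (ω, u) ∂P
      = (P.real {ω | U ω ≤ u} : ℂ) * h u := by
    intro u
    have : (fun ω => S.indicator (fun p : Ω × ℝ => h p.2) (ω, u))
        = {ω | U ω ≤ u}.indicator (fun _ => h u) := by
      ext ω; simp [Set.indicator, S]
    rw [this, integral_indicator_const _ (measurableSet_le hU measurable_const)]
    simp
  have e2 : ∀ᵐ ω ∂P, ∫ u in Set.Ioc (0 : ℝ) 1, S.indicator (fun p : Ω × ℝ => h p.2) (ω, u)
      = Complex.exp (-z) - Complex.exp (-(z / U ω)) := by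
    filter_upwards [hpos] with ω hω
    have : (fun u => S.indicator (fun p : Ω × ℝ => h p.2) (ω, u))
        = (Set.Ici (U ω)).indicator h := by
      ext u; simp [Set.indicator, S]
    rw [this, setIntegral_indicator measurableSet_Ici]
    have hset : Set.Ioc (0 : ℝ) 1 ∩ Set.Ici (U ω) = Set.Icc (U ω) 1 := by
      ext u
      simp only [Set.mem_inter_iff, Set.mem_Ioc, Set.mem_Ici, Set.mem_Icc]
      exact ⟨fun h => ⟨h.2, h.1.2⟩, fun h => ⟨⟨hω.1.trans_le h.1, h.2⟩, h.1⟩⟩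
    rw [hset, integral_Icc_eq_integral_Ioc, hh, integral_mul_exp_neg_div_div_sq_Ioc hω.1 hω.2]
  simp only [e1] at hswap
  rw [integral_congr_ae e2, integral_sub (integrable_const _), integral_const] at hswap
  · rw [← hswap]; simp
  · refine (integrable_const (1 : ℝ)).mono' (by fun_prop : Measurable _).aestronglyMeasurable ?_
    filter_upwards [hpos] with ω hω
    rw [norm_exp_neg_div]
    exact Real.exp_le_one_iff.2 (neg_nonpos.2 (div_nonneg hz.le hω.1.le))

/-- An exact identity whose three right-hand terms are each `o(|z|)`: the summands `1`, `-αγ` and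
`b_F` of `c_F` are absorbed by `e^{-z} - 1`, by `E₁ + log`, and by the `-1` in the last integrand.
-/
theorem integral_exp_neg_div_sub_one_add {Ω : Type*} [MeasurableSpace Ω] (P : Measure Ω)
    [IsProbabilityMeasure P] {U : Ω → ℝ} (hU : Measurable U)
    (hpos : ∀ᵐ ω ∂P, U ω ∈ Set.Ioc (0 : ℝ) 1) {F : ℝ → ℝ}
    (hUF : ∀ u, P.real {ω | U ω ≤ u} = F u) {α : ℝ}
    (hb : IntegrableOn (bIntegrand F α) (Set.Ioc 0 1)) {z : ℂ} (hz : 0 < z.re) :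
    ∫ ω, Complex.exp (-(z / U ω)) ∂P - 1 + z * (cConst F α - α * Complex.log z)
      = (Complex.exp (-z) - 1 + z)
        - z * α * (expIntegralKernel z + Complex.log z + Real.eulerMascheroniConstant)
        - z * ∫ u in Set.Ioc (0 : ℝ) 1, (Complex.exp (-(z / u)) - 1) * (bIntegrand F α u : ℂ) := by
  have hbc : IntegrableOn (fun u => (bIntegrand F α u : ℂ)) (Set.Ioc 0 1) := hb.ofReal
  have hexpb : IntegrableOn (fun u : ℝ => Complex.exp (-(z / u)) * (bIntegrand F α u : ℂ))
      (Set.Ioc 0 1) := by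
    refine hbc.bdd_mul (c := 1) (by fun_prop : Measurable _).aestronglyMeasurable ?_
    filter_upwards [ae_restrict_mem measurableSet_Ioc] with u hu
    rw [norm_exp_neg_div]
    exact Real.exp_le_one_iff.2 (neg_nonpos.2 (div_nonneg hz.le hu.1.le))
  have e1 : ∫ u in Set.Ioc (0 : ℝ) 1,
        (P.real {ω | U ω ≤ u} : ℂ) * (z * (Complex.exp (-(z / u)) / (u : ℂ) ^ 2))
      = z * α * expIntegralKernel z
        + z * ∫ u in Set.Ioc (0 : ℝ) 1, Complex.exp (-(z / u)) * (bIntegrand F α u : ℂ) := by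
    rw [expIntegralKernel, ← integral_const_mul, ← integral_const_mul,
      ← integral_add ((integrableOn_exp_neg_div_div hz).const_mul _) (hexpb.const_mul _)]
    refine setIntegral_congr_fun measurableSet_Ioc fun u hu => ?_
    have h0 : (u : ℂ) ≠ 0 := by exact_mod_cast hu.1.ne'
    simp only [hUF, bIntegrand]
    push_cast
    field_simp
    ring
  have e2 : ∫ u in Set.Ioc (0 : ℝ) 1, (Complex.exp (-(z / u)) - 1) * (bIntegrand F α u : ℂ)
      = (∫ u in Set.Ioc (0 : ℝ) 1, Complex.exp (-(z / u)) * (bIntegrand F α u : ℂ))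
        - ((∫ u in Set.Ioc (0 : ℝ) 1, bIntegrand F α u : ℝ) : ℂ) := by
    rw [← integral_complex_ofReal, ← integral_sub hexpb hbc]
    simp only [sub_mul, one_mul]
  rw [integral_exp_neg_div_eq P hU hpos hz, e1, e2, cConst,
    intervalIntegral.integral_of_le zero_le_one]
  push_cast
  ring

theorem norm_exp_sub_one_le_two_mul_norm {w : ℂ} (hw : w.re ≤ 0) :
    ‖Complex.exp w - 1‖ ≤ 2 * ‖w‖ := by
  by_cases h : ‖w‖ ≤ 1
  · exact Complex.norm_exp_sub_one_le h
  · have h1 : ‖Complex.exp w‖ ≤ 1 := by rw [Complex.norm_exp]; exact Real.exp_le_one_iff.2 hw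
    have h2 := norm_sub_le (Complex.exp w) 1
    rw [norm_one] at h2
    push Not at h
    linarith

/-- Cut the `b`-integral at `δ`. Below, `|e^{-z/u} - 1| ≤ 2` and `∫ |b| ≤ ε`; above, `|e^{-z/u} - 1|
≤ 2|z|/δ` and `b` is bounded. All constants depend on the law only through `A`, `δ`, `ε`. -/
theorem norm_integral_exp_neg_div_sub_one_add_le {Ω : Type*} [MeasurableSpace Ω] (P : Measure Ω)
    [IsProbabilityMeasure P] {U : Ω → ℝ} (hU : Measurable U)
    (hpos : ∀ᵐ ω ∂P, U ω ∈ Set.Ioc (0 : ℝ) 1) {F : ℝ → ℝ} (hmono : Monotone F)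
    (hF0 : F 0 = 0) (hF1 : F 1 = 1)
    (hUF : ∀ u, P.real {ω | U ω ≤ u} = F u) {α A : ℝ} (hα : 0 < α) (hA : α ≤ A)
    (hb : IntegrableOn (bIntegrand F α) (Set.Ioc 0 1)) {δ ε : ℝ} (hδ : 0 < δ) (hδ1 : δ ≤ 1)
    (hε : ∫ u in Set.Ioo 0 δ, |bIntegrand F α u| ≤ ε) {z : ℂ} (hz : 0 < z.re) (hz1 : ‖z‖ ≤ 1) :
    ‖∫ ω, Complex.exp (-(z / U ω)) ∂P - 1 + z * (cConst F α - α * Complex.log z)‖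
      ≤ ‖z‖ * (2 * ε + ‖z‖ * (1 + 2 * A + 2 / δ * (1 / δ * (1 / δ + A)))) := by
  set C := 1 / δ * (1 / δ + A)
  have hA0 : 0 < A := hα.trans_le hA
  have hC : 0 ≤ C := by positivity
  rw [integral_exp_neg_div_sub_one_add P hU hpos hUF hb hz]
  have h1 : ‖Complex.exp (-z) - 1 + z‖ ≤ ‖z‖ ^ 2 := by
    have := Complex.norm_exp_sub_one_sub_id_le (x := -z) (by rwa [norm_neg])
    rwa [norm_neg, sub_neg_eq_add] at this
  have h2 : ‖z * α * (expIntegralKernel z + Complex.log z + Real.eulerMascheroniConstant)‖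
      ≤ ‖z‖ * A * (2 * ‖z‖) := by
    rw [norm_mul, norm_mul, Complex.norm_real, Real.norm_eq_abs, abs_of_pos hα]
    have := norm_expIntegralKernel_add_log_le hz hz1
    gcongr
  have h3 : ‖∫ u in Set.Ioc (0 : ℝ) 1, (Complex.exp (-(z / u)) - 1) * (bIntegrand F α u : ℂ)‖
      ≤ 2 * ε + 2 * ‖z‖ / δ * C := by
    have hbound : ∀ u ∈ Set.Ioc (0 : ℝ) 1,
        ‖(Complex.exp (-(z / u)) - 1) * (bIntegrand F α u : ℂ)‖
          ≤ (Set.Ioo 0 δ).indicator (fun u => 2 * |bIntegrand F α u|) u + 2 * ‖z‖ / δ * C := by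
      intro u hu
      have hre : (-(z / u)).re ≤ 0 := by
        rw [Complex.neg_re, Complex.div_ofReal_re]
        exact neg_nonpos.2 (div_nonneg hz.le hu.1.le)
      rw [norm_mul, Complex.norm_real, Real.norm_eq_abs]
      by_cases hud : u < δ
      · rw [Set.indicator_of_mem (show u ∈ Set.Ioo 0 δ from ⟨hu.1, hud⟩)]
        have h4 : ‖Complex.exp (-(z / u)) - 1‖ ≤ 2 := by
          have h1 : ‖Complex.exp (-(z / u))‖ ≤ 1 := by
            rw [Complex.norm_exp]; exact Real.exp_le_one_iff.2 hre
          have h2 := norm_sub_le (Complex.exp (-(z / u))) 1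
          rw [norm_one] at h2
          linarith
        have : 0 ≤ 2 * ‖z‖ / δ * C := by positivity
        have := mul_le_mul_of_nonneg_right h4 (abs_nonneg (bIntegrand F α u))
        linarith
      · rw [Set.indicator_of_notMem (fun h => hud h.2), zero_add]
        push Not at hud
        have h4 := norm_exp_sub_one_le_two_mul_norm hre
        rw [norm_neg, norm_div, Complex.norm_real, Real.norm_eq_abs, abs_of_pos hu.1] at h4
        have h5 : 2 * (‖z‖ / u) ≤ 2 * ‖z‖ / δ := by rw [mul_div_assoc]; gcongr
        exact mul_le_mul (h4.trans h5) (abs_bIntegrand_le hmono hF0 hF1 hα hA hδ hud hu.2)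
          (abs_nonneg _) (by positivity)
    have hsub : Set.Ioo 0 δ ⊆ Set.Ioc (0 : ℝ) 1 := fun u hu => ⟨hu.1, hu.2.le.trans hδ1⟩
    have hi1 : IntegrableOn ((Set.Ioo 0 δ).indicator fun u => 2 * |bIntegrand F α u|)
        (Set.Ioc 0 1) := by
      have : IntegrableOn (fun u => 2 * |bIntegrand F α u|) (Set.Ioc 0 1) := hb.abs.const_mul 2
      exact this.indicator measurableSet_Ioo
    have hi2 : IntegrableOn (fun _ : ℝ => 2 * ‖z‖ / δ * C) (Set.Ioc 0 1) := integrable_const _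
    refine (norm_integral_le_of_norm_le (hi1.add hi2)
      ((ae_restrict_iff' measurableSet_Ioc).2 (Eventually.of_forall hbound))).trans ?_
    rw [integral_add' hi1 hi2, setIntegral_indicator measurableSet_Ioo,
      Set.inter_eq_right.2 hsub, integral_const_mul, setIntegral_const]
    simp
    linarith
  calc _ ≤ ‖z‖ ^ 2 + ‖z‖ * A * (2 * ‖z‖) + ‖z‖ * (2 * ε + 2 * ‖z‖ / δ * C) := by
        refine (norm_sub_le _ _).trans (add_le_add ((norm_sub_le _ _).trans (add_le_add h1 h2)) ?_)
        rw [norm_mul]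
        gcongr
    _ = _ := by ring

/-! ### Estimates uniform along the sequence of laws. -/

/-- The random variables `U n` take values in `(0, 1]` and have distribution functions `F n`. -/
structure IsUnitFamily {Ω : Type*} [MeasurableSpace Ω] (P : Measure Ω) (U : ℕ → Ω → ℝ)
    (F : ℕ → ℝ → ℝ) : Prop where
  measurable : ∀ n, Measurable (U n)
  mem_Ioc : ∀ n, ∀ᵐ ω ∂P, U n ω ∈ Set.Ioc (0 : ℝ) 1
  mono : ∀ n, Monotone (F n)
  zero : ∀ n, F n 0 = 0
  one : ∀ n, F n 1 = 1
  prob_le : ∀ n u, P.real {ω | U n ω ≤ u} = F n u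

theorem isUnitFamily_of_cdf {Ω : Type*} [MeasurableSpace Ω] (P : Measure Ω)
    [IsProbabilityMeasure P] {U : ℕ → Ω → ℝ} {F : ℕ → StieltjesFunction ℝ}
    (hU : ∀ n, Measurable (U n)) (hUF : ∀ n, cdf (P.map (U n)) = F n)
    (hF0 : ∀ n, F n 0 = 0) (hF1 : ∀ n, F n 1 = 1) :
    IsUnitFamily P U (fun n => F n) := by
  have hle : ∀ n u, P.real {ω | U n ω ≤ u} = F n u := by
    intro n u
    have : IsProbabilityMeasure (P.map (U n)) := Measure.isProbabilityMeasure_map (hU n).aemeasurable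
    rw [← hUF n, cdf_eq_real, map_measureReal_apply (hU n) measurableSet_Iic]
    rfl
  refine ⟨hU, fun n => ?_, fun n => (F n).mono, hF0, hF1, hle⟩
  have h0 : ∀ᵐ ω ∂P, ¬ U n ω ≤ 0 := by
    have := hle n 0
    rw [hF0, measureReal_eq_zero_iff] at this
    rw [ae_iff]
    simpa using this
  have h1 : ∀ᵐ ω ∂P, U n ω ≤ 1 := by
    have h := hle n 1
    rw [hF1] at h
    have h2 : P {ω | U n ω ≤ 1} = 1 := by
      rw [← ofReal_measureReal, h, ENNReal.ofReal_one]
    exact (prob_compl_eq_zero_iff (measurableSet_le (hU n) measurable_const)).2 h2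
  filter_upwards [h0, h1] with ω h h'
  exact ⟨not_le.1 h, h'⟩

/-- One `δ` serves all `n`. The extended-valued supremum being below `ε` yields integrability as
well as the bound. -/
theorem UniformlyIntegrableAtZero.exists_integral_le {F : ℕ → ℝ → ℝ} {α : ℕ → ℝ}
    (hmono : ∀ n, Monotone (F n)) (hii : UniformlyIntegrableAtZero F α) {ε : ℝ} (hε : 0 < ε) :
    ∃ δ : ℝ, 0 < δ ∧ δ ≤ 1 ∧ ∀ n, IntegrableOn (bIntegrand (F n) (α n)) (Set.Ioo 0 δ) ∧
      ∫ u in Set.Ioo 0 δ, |bIntegrand (F n) (α n) u| ≤ ε := by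
  have h := (hii.eventually (gt_mem_nhds (ENNReal.ofReal_pos.2 hε))).and (Ioc_mem_nhdsGT one_pos)
  obtain ⟨δ, hδ, hδ0, hδ1⟩ := h.exists
  refine ⟨δ, hδ0, hδ1, fun n => ?_⟩
  have hn : ∫⁻ u in Set.Ioo 0 δ, ENNReal.ofReal |bIntegrand (F n) (α n) u| ≤ ENNReal.ofReal ε := by
    refine le_trans ?_ hδ.le
    refine le_trans (le_of_eq ?_) (le_iSup _ n)
    refine setLIntegral_congr_fun measurableSet_Ioo fun u hu => ?_
    rw [abs_bIntegrand _ hu.1]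
  have hm := (measurable_bIntegrand (hmono n) (α n)).aestronglyMeasurable
    (μ := volume.restrict (Set.Ioo 0 δ))
  constructor
  · refine ⟨hm, ?_⟩
    rw [hasFiniteIntegral_iff_norm]
    exact hn.trans_lt ENNReal.ofReal_lt_top
  · rw [integral_eq_lintegral_of_nonneg_ae (Eventually.of_forall fun _ => abs_nonneg _) hm.norm]
    exact ENNReal.toReal_le_of_le_ofReal hε.le hn

theorem exists_bound_of_tendsto {α : ℕ → ℝ} {α₀ : ℝ} (hα : Tendsto α atTop (𝓝 α₀)) :
    ∃ A, 0 < A ∧ ∀ n, |α n| ≤ A := by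
  obtain ⟨B, hB⟩ := hα.abs.bddAbove_range
  exact ⟨max B 1, by positivity, fun n => (hB ⟨n, rfl⟩).trans (le_max_left _ _)⟩

theorem exists_abs_bIntegrand_integral_le {F : ℕ → ℝ → ℝ} {α : ℕ → ℝ}
    (hmono : ∀ n, Monotone (F n)) (h0 : ∀ n, F n 0 = 0) (h1 : ∀ n, F n 1 = 1)
    (hpos : ∀ n, 0 < α n) {A : ℝ} (hA : ∀ n, α n ≤ A) (hii : UniformlyIntegrableAtZero F α) :
    ∃ M, ∀ n, IntegrableOn (bIntegrand (F n) (α n)) (Set.Ioc 0 1) ∧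
      |∫ u in Set.Ioc 0 1, bIntegrand (F n) (α n) u| ≤ M := by
  obtain ⟨δ, hδ0, hδ1, hδ⟩ := hii.exists_integral_le hmono one_pos
  refine ⟨1 + 1 / δ * (1 / δ + A) * (1 - δ), fun n => ?_⟩
  have hset : Set.Ioc (0 : ℝ) 1 = Set.Ioo 0 δ ∪ Set.Icc δ 1 :=
    (Set.Ioo_union_Icc_eq_Ioc hδ0 hδ1).symm
  have hdisj : Disjoint (Set.Ioo 0 δ) (Set.Icc δ 1) := by
    rw [Set.disjoint_left]; exact fun u hu hu' => hu.2.not_ge hu'.1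
  have hb : ∀ u ∈ Set.Icc δ 1, ‖bIntegrand (F n) (α n) u‖ ≤ 1 / δ * (1 / δ + A) :=
    fun u hu => abs_bIntegrand_le (hmono n) (h0 n) (h1 n) (hpos n) (hA n) hδ0 hu.1 hu.2
  have hi : IntegrableOn (bIntegrand (F n) (α n)) (Set.Icc δ 1) :=
    Measure.integrableOn_of_bounded (by simp)
      (measurable_bIntegrand (hmono n) (α n)).aestronglyMeasurable
      ((ae_restrict_iff' measurableSet_Icc).2 (Eventually.of_forall hb))
  rw [hset]
  refine ⟨(hδ n).1.union hi, ?_⟩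
  rw [setIntegral_union hdisj measurableSet_Icc (hδ n).1 hi]
  refine (abs_add_le _ _).trans (add_le_add ?_ ?_)
  · exact (abs_integral_le_integral_abs).trans (hδ n).2
  · have := norm_setIntegral_le_of_norm_le_const (μ := volume) (by simp) hb
    simpa [hδ1] using this

theorem exists_abs_cConst_le {F : ℕ → ℝ → ℝ} {α : ℕ → ℝ}
    (hmono : ∀ n, Monotone (F n)) (h0 : ∀ n, F n 0 = 0) (h1 : ∀ n, F n 1 = 1)
    (hpos : ∀ n, 0 < α n) {A : ℝ} (hA : ∀ n, α n ≤ A) (hii : UniformlyIntegrableAtZero F α) :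
    ∃ C, 0 ≤ C ∧ ∀ n, |cConst (F n) (α n)| ≤ C := by
  obtain ⟨M, hM⟩ := exists_abs_bIntegrand_integral_le hmono h0 h1 hpos hA hii
  have hM0 : 0 ≤ M := (abs_nonneg _).trans (hM 0).2
  have hA0 : 0 < A := (hpos 0).trans_le (hA 0)
  refine ⟨1 + A * |Real.eulerMascheroniConstant| + M, by positivity, fun n => ?_⟩
  rw [cConst, intervalIntegral.integral_of_le zero_le_one]
  refine (abs_add_le _ _).trans (add_le_add ((abs_sub _ _).trans ?_) (hM n).2)
  rw [abs_one, abs_mul, abs_of_pos (hpos n)]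
  gcongr
  exact hA n

theorem IsUnitFamily.exists_norm_sub_one_add_le {Ω : Type*} [MeasurableSpace Ω] {P : Measure Ω}
    [IsProbabilityMeasure P] {U : ℕ → Ω → ℝ} {F : ℕ → ℝ → ℝ} {α : ℕ → ℝ}
    (h : IsUnitFamily P U F) (hpos : ∀ n, 0 < α n) {A : ℝ} (hA : ∀ n, α n ≤ A)
    (hii : UniformlyIntegrableAtZero F α) {η : ℝ} (hη : 0 < η) :
    ∃ ρ > 0, ∀ n, ∀ z : ℂ, 0 < z.re → ‖z‖ < ρ →
      ‖∫ ω, Complex.exp (-(z / U n ω)) ∂P - 1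
        + z * (cConst (F n) (α n) - α n * Complex.log z)‖ ≤ η * ‖z‖ := by
  obtain ⟨M, hM⟩ := exists_abs_bIntegrand_integral_le h.mono h.zero h.one hpos hA hii
  -- The term `2ε` with `ε = η / 4` uses half of `η`; the radius below makes `‖z‖ * D` at most the
  -- other half.
  obtain ⟨δ, hδ0, hδ1, hδ⟩ := hii.exists_integral_le h.mono (show 0 < η / 4 by positivity)
  have hA0 : 0 < A := (hpos 0).trans_le (hA 0)
  set D := 1 + 2 * A + 2 / δ * (1 / δ * (1 / δ + A))
  have hD : 0 < D := by positivity
  refine ⟨min 1 (η / (2 * D)), by positivity, fun n z hz hzρ => ?_⟩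
  have h1 : ‖z‖ ≤ 1 := (hzρ.trans_le (min_le_left _ _)).le
  have h2 : ‖z‖ * D ≤ η / 2 := by
    have := (hzρ.trans_le (min_le_right _ _)).le
    rw [le_div_iff₀ (by positivity)] at this
    linarith
  refine (norm_integral_exp_neg_div_sub_one_add_le P (h.measurable n) (h.mem_Ioc n) (h.mono n)
    (h.zero n) (h.one n) (h.prob_le n) (hpos n) (hA n) (hM n).1 hδ0 hδ1 (hδ n).2 hz h1).trans ?_
  rw [mul_comm η]
  gcongr
  linarith

theorem tendsto_integral_exp_neg_div {Ω : Type*} [MeasurableSpace Ω] (P : Measure Ω)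
    [IsProbabilityMeasure P] {U : Ω → ℝ} (hU : Measurable U)
    (hpos : ∀ᵐ ω ∂P, U ω ∈ Set.Ioc (0 : ℝ) 1) {w : ℂ} (hw : w.re = 0) :
    Tendsto (fun ε : ℝ => ∫ ω, Complex.exp (-((ε + w) / U ω)) ∂P) (𝓝[>] 0)
      (𝓝 (∫ ω, Complex.exp (-(w / U ω)) ∂P)) := by
  refine tendsto_integral_filter_of_dominated_convergence (fun _ => 1) ?_ ?_
    (integrable_const _) ?_
  · exact Eventually.of_forall fun ε => (by fun_prop : Measurable _).aestronglyMeasurable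
  · filter_upwards [self_mem_nhdsWithin] with ε hε
    filter_upwards [hpos] with ω hω
    rw [norm_exp_neg_div]
    refine Real.exp_le_one_iff.2 (neg_nonpos.2 (div_nonneg ?_ hω.1.le))
    simpa [hw] using (Set.mem_Ioi.1 hε).le
  · filter_upwards with ω
    have : Continuous fun ε : ℝ => Complex.exp (-((ε + w) / U ω)) := by fun_prop
    have h := this.tendsto 0
    simp only [Complex.ofReal_zero, zero_add] at h
    exact h.mono_left nhdsWithin_le_nhds

/-- Apply the half-plane bound at `ε + z` and let `ε → 0+`. A nonzero imaginary `z` is off the cut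
of the principal logarithm. -/
theorem IsUnitFamily.exists_norm_sub_one_add_le_of_re_eq_zero {Ω : Type*} [MeasurableSpace Ω]
    {P : Measure Ω}
    [IsProbabilityMeasure P] {U : ℕ → Ω → ℝ} {F : ℕ → ℝ → ℝ} {α : ℕ → ℝ}
    (h : IsUnitFamily P U F) (hpos : ∀ n, 0 < α n) {A : ℝ} (hA : ∀ n, α n ≤ A)
    (hii : UniformlyIntegrableAtZero F α) {η : ℝ} (hη : 0 < η) :
    ∃ ρ > 0, ∀ n, ∀ z : ℂ, z.re = 0 → z ≠ 0 → ‖z‖ < ρ →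
      ‖∫ ω, Complex.exp (-(z / U n ω)) ∂P - 1
        + z * (cConst (F n) (α n) - α n * Complex.log z)‖ ≤ η * ‖z‖ := by
  obtain ⟨ρ, hρ, hb⟩ := h.exists_norm_sub_one_add_le hpos hA hii hη
  refine ⟨ρ, hρ, fun n z hz hz0 hzρ => ?_⟩
  have hc : Continuous fun ε : ℝ => (ε : ℂ) + z := by fun_prop
  have h0 : Tendsto (fun ε : ℝ => (ε : ℂ) + z) (𝓝[>] 0) (𝓝 z) := by
    have := hc.tendsto 0
    simp only [Complex.ofReal_zero, zero_add] at this
    exact this.mono_left nhdsWithin_le_nhds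
  have hslit : z ∈ Complex.slitPlane := Or.inr fun him => hz0 (Complex.ext hz him)
  have hlog := h0.clog hslit
  have hl := (((tendsto_integral_exp_neg_div P (h.measurable n) (h.mem_Ioc n) hz).sub_const 1).add
    (h0.mul ((hlog.const_mul (α n : ℂ)).const_sub (cConst (F n) (α n) : ℂ)))).norm
  refine le_of_tendsto_of_tendsto hl (h0.norm.const_mul η) ?_
  filter_upwards [self_mem_nhdsWithin, h0.norm.eventually (gt_mem_nhds hzρ)] with ε hε hε2
  exact hb n _ (by simpa [hz] using hε) hε2

/-- The expansion gives `|ψ - 1| = O(|z| (1 + |log |z||))`, whose square is `o(|z|)`. -/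
theorem IsUnitFamily.exists_norm_sub_one_sq_le {Ω : Type*} [MeasurableSpace Ω]
    {P : Measure Ω}
    [IsProbabilityMeasure P] {U : ℕ → Ω → ℝ} {F : ℕ → ℝ → ℝ} {α : ℕ → ℝ}
    (h : IsUnitFamily P U F) (hpos : ∀ n, 0 < α n) {A : ℝ} (hA : ∀ n, α n ≤ A)
    (hii : UniformlyIntegrableAtZero F α) {η : ℝ} (hη : 0 < η) :
    ∃ ρ > 0, ∀ n, ∀ z : ℂ, z.re = 0 → z ≠ 0 → ‖z‖ < ρ →
      ‖∫ ω, Complex.exp (-(z / U n ω)) ∂P - 1‖ ^ 2 ≤ η * ‖z‖ := by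
  obtain ⟨C, hC0, hC⟩ := exists_abs_cConst_le h.mono h.zero h.one hpos hA hii
  obtain ⟨ρ, hρ, hb⟩ := h.exists_norm_sub_one_add_le_of_re_eq_zero hpos hA hii one_pos
  have hA0 : 0 < A := (hpos 0).trans_le (hA 0)
  -- The `1` is the error with `η = 1`, `C` bounds the constants `c_F`, and `π` bounds the argument
  -- in `log z`.
  set B := 1 + C + A * Real.pi
  have hlim : Tendsto (fun x : ℝ => (x ^ (1 / 2 : ℝ) * B + A * |Real.log x * x ^ (1 / 2 : ℝ)|) ^ 2)
      (𝓝[>] 0) (𝓝 0) := by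
    have h1 : Tendsto (fun x : ℝ => x ^ (1 / 2 : ℝ)) (𝓝[>] 0) (𝓝 0) := by
      have := (Real.continuousAt_rpow_const 0 (1 / 2 : ℝ) (Or.inr (by norm_num))).tendsto
      rw [Real.zero_rpow (by norm_num)] at this
      exact this.mono_left nhdsWithin_le_nhds
    have h2 := tendsto_log_mul_rpow_nhdsGT_zero (show (0 : ℝ) < 1 / 2 by norm_num)
    simpa using ((h1.mul_const B).add (h2.abs.const_mul A)).pow 2
  obtain ⟨ρ', hρ', hsub⟩ := (mem_nhdsGT_iff_exists_Ioo_subset).1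
    (hlim.eventually (gt_mem_nhds hη))
  refine ⟨min ρ ρ', lt_min hρ hρ', fun n z hz hz0 hzρ => ?_⟩
  have hx : 0 < ‖z‖ := norm_pos_iff.2 hz0
  have h1 := hb n z hz hz0 (hzρ.trans_le (min_le_left _ _))
  have h2 : (‖z‖ ^ (1 / 2 : ℝ) * B + A * |Real.log ‖z‖ * ‖z‖ ^ (1 / 2 : ℝ)|) ^ 2 < η :=
    hsub ⟨hx, hzρ.trans_le (min_le_right _ _)⟩
  have hlog : ‖Complex.log z‖ ≤ |Real.log ‖z‖| + Real.pi := by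
    have h3 := Complex.norm_le_abs_re_add_abs_im (Complex.log z)
    rw [Complex.log_re, Complex.log_im] at h3
    linarith [Complex.abs_arg_le_pi z]
  have h3 : ‖(cConst (F n) (α n) - α n * Complex.log z : ℂ)‖
      ≤ C + A * (|Real.log ‖z‖| + Real.pi) := by
    refine (norm_sub_le _ _).trans (add_le_add ?_ ?_)
    · rw [Complex.norm_real]; exact hC n
    · rw [norm_mul, Complex.norm_real, Real.norm_eq_abs, abs_of_pos (hpos n)]
      exact mul_le_mul (hA n) hlog (norm_nonneg _) hA0.le
  have h4 : ‖∫ ω, Complex.exp (-(z / U n ω)) ∂P - 1‖ ≤ ‖z‖ * (B + A * |Real.log ‖z‖|) := by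
    have h5 := norm_sub_le (∫ ω, Complex.exp (-(z / U n ω)) ∂P - 1
        + z * (cConst (F n) (α n) - α n * Complex.log z))
        (z * (cConst (F n) (α n) - α n * Complex.log z))
    rw [add_sub_cancel_right, norm_mul z] at h5
    have h6 := mul_le_mul_of_nonneg_left h3 hx.le
    calc _ ≤ _ := h5
      _ ≤ 1 * ‖z‖ + ‖z‖ * (C + A * (|Real.log ‖z‖| + Real.pi)) := add_le_add h1 h6
      _ = _ := by ring
  have hsq : ‖z‖ ^ (1 / 2 : ℝ) * ‖z‖ ^ (1 / 2 : ℝ) = ‖z‖ := by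
    rw [← Real.rpow_add hx]; norm_num
  have hrp : 0 < ‖z‖ ^ (1 / 2 : ℝ) := Real.rpow_pos_of_pos hx _
  rw [abs_mul, abs_of_pos hrp] at h2
  set q := ‖z‖ ^ (1 / 2 : ℝ)
  calc _ ≤ (‖z‖ * (B + A * |Real.log ‖z‖|)) ^ 2 := by gcongr
    _ = (q * B + A * (|Real.log ‖z‖| * q)) ^ 2 * ‖z‖ := by
      have e : ∀ l : ℝ, (‖z‖ * (B + A * l)) ^ 2 = (q * B + A * (l * q)) ^ 2 * ‖z‖ := by
        intro l
        rw [← hsq]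
        ring
      exact e _
    _ ≤ η * ‖z‖ := by gcongr

/-! ### Products of factors in the unit disc, and weight arrays. -/

theorem norm_prod_sub_prod_le {ι : Type*} (s : Finset ι) {z w : ι → ℂ}
    (hz : ∀ i ∈ s, ‖z i‖ ≤ 1) (hw : ∀ i ∈ s, ‖w i‖ ≤ 1) :
    ‖∏ i ∈ s, z i - ∏ i ∈ s, w i‖ ≤ ∑ i ∈ s, ‖z i - w i‖ := by
  classical
  induction s using Finset.induction_on with
  | empty => simp
  | insert i s hi ih =>
    rw [Finset.prod_insert hi, Finset.prod_insert hi, Finset.sum_insert hi]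
    have h1 := ih (fun j hj => hz j (Finset.mem_insert_of_mem hj))
      (fun j hj => hw j (Finset.mem_insert_of_mem hj))
    have h2 : ‖∏ j ∈ s, z j‖ ≤ 1 := by
      rw [norm_prod]
      exact Finset.prod_le_one (fun _ _ => norm_nonneg _)
        (fun j hj => hz j (Finset.mem_insert_of_mem hj))
    have h3 := hw i (Finset.mem_insert_self i s)
    calc ‖z i * ∏ j ∈ s, z j - w i * ∏ j ∈ s, w j‖
        = ‖(z i - w i) * ∏ j ∈ s, z j + w i * (∏ j ∈ s, z j - ∏ j ∈ s, w j)‖ := by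
          congr 1; ring
      _ ≤ ‖z i - w i‖ * ‖∏ j ∈ s, z j‖ + ‖w i‖ * ‖∏ j ∈ s, z j - ∏ j ∈ s, w j‖ := by
          refine (norm_add_le _ _).trans ?_
          rw [norm_mul, norm_mul]
      _ ≤ ‖z i - w i‖ * 1 + 1 * ∑ j ∈ s, ‖z j - w j‖ := by gcongr
      _ = _ := by ring

/-- Replacing `ψ` by `exp (ψ - 1)` turns products into sums without taking logarithms of `ψ`. -/
theorem norm_sub_exp_sub_one_le {z : ℂ} (hz : ‖z - 1‖ ≤ 1) :
    ‖z - Complex.exp (z - 1)‖ ≤ ‖z - 1‖ ^ 2 := by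
  have h := Complex.norm_exp_sub_one_sub_id_le hz
  rw [← norm_neg] at h
  refine le_of_eq_of_le (congrArg _ ?_) h
  ring

theorem norm_exp_sub_one_le_one {z : ℂ} (hz : ‖z‖ ≤ 1) : ‖Complex.exp (z - 1)‖ ≤ 1 := by
  rw [Complex.norm_exp, Real.exp_le_one_iff, Complex.sub_re, Complex.one_re]
  linarith [Complex.re_le_norm z]

theorem IsWeightArray.le_iSup {a : ℕ → ℕ → ℝ} {n k : ℕ} (hk : k < n) :
    a k n ≤ ⨆ k : Fin n, a k n :=
  le_ciSup (f := fun k : Fin n => a k n) (Set.finite_range _).bddAbove ⟨k, hk⟩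

theorem IsWeightArray.tendsto_sum_zero {E : Type*} [NormedAddCommGroup E] {a : ℕ → ℕ → ℝ} {κ : ℝ}
    (ha : IsWeightArray a κ) {e : ℕ → ℕ → E} {τ : ℝ} (hτ : 0 < τ)
    (he : ∀ η > 0, ∃ ρ > 0, ∀ k n, k < n → a k n * τ < ρ → ‖e k n‖ ≤ η * (a k n * τ)) :
    Tendsto (fun n => ∑ k ∈ Finset.range n, e k n) atTop (𝓝 0) := by
  rw [Metric.tendsto_nhds]
  intro ε hε
  have hκ : 0 ≤ κ := ge_of_tendsto' ha.tendsto_sum fun n =>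
    Finset.sum_nonneg fun k hk => (ha.pos n k (Finset.mem_range.1 hk)).le
  -- `κ + 1` is positive even if `κ = 0`, and eventually exceeds the row sums.
  obtain ⟨ρ, hρ, hb⟩ := he (ε / (τ * (κ + 1))) (by positivity)
  have h1 := ha.tendsto_max.eventually (gt_mem_nhds (show (0 : ℝ) < ρ / τ by positivity))
  have h2 := ha.tendsto_sum.eventually (gt_mem_nhds (lt_add_one κ))
  filter_upwards [h1, h2] with n hn1 hn2
  rw [dist_zero_right]
  calc ‖∑ k ∈ Finset.range n, e k n‖
      ≤ ∑ k ∈ Finset.range n, ε / (τ * (κ + 1)) * (a k n * τ) := by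
        refine norm_sum_le_of_le _ fun k hk => ?_
        have hk' := Finset.mem_range.1 hk
        refine hb k n hk' ?_
        have := (IsWeightArray.le_iSup hk').trans_lt hn1
        rwa [lt_div_iff₀ hτ] at this
    _ = ε * ((∑ k ∈ Finset.range n, a k n) / (κ + 1)) := by
        rw [← Finset.mul_sum, ← Finset.sum_mul]
        field_simp
    _ < ε * 1 := by
        gcongr
        rw [div_lt_one (by positivity)]
        exact hn2
    _ = ε := mul_one ε

theorem IsWeightArray.tendsto_entry {a : ℕ → ℕ → ℝ} {κ : ℝ} (ha : IsWeightArray a κ) (k : ℕ) :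
    Tendsto (fun n => a k n) atTop (𝓝 0) := by
  refine squeeze_zero' ?_ ?_ ha.tendsto_max
  · filter_upwards [eventually_gt_atTop k] with n hn using (ha.pos n k hn).le
  · filter_upwards [eventually_gt_atTop k] with n hn using IsWeightArray.le_iSup hn

/-- A Toeplitz argument: finitely many columns vanish in the limit, and beyond them `α k` is close
to `α₀` while the total weight stays bounded. -/
theorem IsWeightArray.tendsto_sum_mul {a : ℕ → ℕ → ℝ} {κ : ℝ} (ha : IsWeightArray a κ)
    {α : ℕ → ℝ} {α₀ : ℝ} (hα : Tendsto α atTop (𝓝 α₀)) :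
    Tendsto (fun n => ∑ k ∈ Finset.range n, α k * a k n) atTop (𝓝 (α₀ * κ)) := by
  suffices h : Tendsto (fun n => ∑ k ∈ Finset.range n, (α k - α₀) * a k n) atTop (𝓝 0) by
    have := h.add (ha.tendsto_sum.const_mul α₀)
    rw [zero_add] at this
    refine this.congr fun n => ?_
    rw [Finset.mul_sum, ← Finset.sum_add_distrib]
    exact Finset.sum_congr rfl fun k _ => by ring
  rw [Metric.tendsto_nhds]
  intro ε hε
  have hκ : 0 ≤ κ := ge_of_tendsto' ha.tendsto_sum fun n =>
    Finset.sum_nonneg fun k hk => (ha.pos n k (Finset.mem_range.1 hk)).le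
  set η := ε / (2 * (κ + 1)) with hη
  have hη0 : 0 < η := by positivity
  obtain ⟨K, hK⟩ := Metric.tendsto_atTop.1 hα η hη0
  have h1 : Tendsto (fun n => ∑ k ∈ Finset.range K, |α k - α₀| * a k n) atTop (𝓝 0) := by
    have := tendsto_finsetSum (Finset.range K)
      (fun k _ => (ha.tendsto_entry k).const_mul |α k - α₀|)
    simpa using this
  filter_upwards [h1.eventually (gt_mem_nhds (half_pos hε)),
    ha.tendsto_sum.eventually (gt_mem_nhds (lt_add_one κ)), eventually_ge_atTop K] with n hn1 hn2 hn3
  rw [dist_zero_right]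
  have hpos : ∀ k ∈ Finset.range n, 0 < a k n := fun k hk => ha.pos n k (Finset.mem_range.1 hk)
  have hsplit := Finset.sum_range_add_sum_Ico (fun k => |α k - α₀| * a k n) hn3
  have hIco : ∑ k ∈ Finset.Ico K n, |α k - α₀| * a k n ≤ η * ∑ k ∈ Finset.range n, a k n := by
    rw [Finset.mul_sum]
    have hsub : Finset.Ico K n ⊆ Finset.range n := fun k hk =>
      Finset.mem_range.2 (Finset.mem_Ico.1 hk).2
    refine (Finset.sum_le_sum fun k hk => ?_).trans
      (Finset.sum_le_sum_of_subset_of_nonneg hsub fun k hk _ => by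
        have := hpos k hk; positivity)
    have := (hK k (Finset.mem_Ico.1 hk).1).le
    rw [Real.dist_eq] at this
    exact mul_le_mul_of_nonneg_right this (hpos k (hsub hk)).le
  have hlast : η * ∑ k ∈ Finset.range n, a k n ≤ ε / 2 := by
    calc _ ≤ η * (κ + 1) := by gcongr
      _ = ε / 2 := by rw [hη]; field_simp
  calc ‖∑ k ∈ Finset.range n, (α k - α₀) * a k n‖
      ≤ ∑ k ∈ Finset.range n, |α k - α₀| * a k n := by
        refine norm_sum_le_of_le _ fun k hk => ?_
        rw [norm_mul, Real.norm_eq_abs, Real.norm_eq_abs, abs_of_pos (hpos k hk)]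
    _ < ε := by linarith

/-! ### Characteristic functions and convergence in law. -/

/-- A **Lévy continuity theorem**: a pointwise limit of characteristic functions which is continuous
at `0` is the characteristic function of a probability measure, the limit in law. -/
theorem exists_probabilityMeasure_of_tendsto_charFun {μ : ℕ → ProbabilityMeasure ℝ} {f : ℝ → ℂ}
    (hf : ContinuousAt f 0)
    (h : ∀ t, Tendsto (fun n => charFun (μ n : Measure ℝ) t) atTop (𝓝 (f t))) :
    ∃ ν : ProbabilityMeasure ℝ, (∀ t, charFun (ν : Measure ℝ) t = f t) ∧
      Tendsto μ atTop (𝓝 ν) := by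
  have htight : IsTightMeasureSet (Set.range fun n => (μ n : Measure ℝ)) :=
    isTightMeasureSet_of_tendsto_charFun hf h
  have hset : {((ν : ProbabilityMeasure ℝ) : Measure ℝ) | ν ∈ Set.range μ}
      = Set.range fun n => (μ n : Measure ℝ) := by
    ext m; simp
  have hcomp : IsCompact (closure (Set.range μ)) :=
    isCompact_closure_of_isTightMeasureSet (hset ▸ htight)
  -- Prokhorov supplies a subsequential limit; its characteristic function must be `f`, so the whole
  -- sequence converges to it.
  obtain ⟨ν, -, φ, hφ, hν⟩ := hcomp.tendsto_subseq fun n => subset_closure (Set.mem_range_self n)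
  have hc : ∀ t, charFun (ν : Measure ℝ) t = f t := fun t =>
    tendsto_nhds_unique (ProbabilityMeasure.tendsto_iff_tendsto_charFun.1 hν t)
      ((h t).comp hφ.tendsto_atTop)
  refine ⟨ν, hc, ProbabilityMeasure.tendsto_iff_tendsto_charFun.2 fun t => ?_⟩
  rw [hc t]
  exact h t

/-- The principal argument of `-it` is `-π/2` times the sign of `t`, which produces the `π|t|/2` of
the limit law. -/
theorem neg_I_mul_log_neg_I {t : ℝ} (ht : t ≠ 0) :
    -(Complex.I * t) * Complex.log (-(Complex.I * t))
      = -(Complex.I * (t * Real.log |t| : ℝ)) - (Real.pi * |t| / 2 : ℝ) := by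
  rcases ht.lt_or_gt with h | h
  · have e : -(Complex.I * t) = ((-t : ℝ) : ℂ) * Complex.I := by push_cast; ring
    rw [e, Complex.log_ofReal_mul (neg_pos.2 h) Complex.I_ne_zero, Complex.log_I, abs_of_neg h]
    push_cast
    linear_combination (-(t : ℂ) * Real.pi / 2) * Complex.I_mul_I
  · have e : -(Complex.I * t) = (t : ℂ) * -Complex.I := by ring
    rw [e, Complex.log_ofReal_mul h (neg_ne_zero.2 Complex.I_ne_zero), Complex.log_neg_I,
      abs_of_pos h]
    push_cast
    linear_combination ((t : ℂ) * Real.pi / 2) * Complex.I_mul_I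

theorem measurable_centredSum {Ω : Type*} [MeasurableSpace Ω] {a : ℕ → ℕ → ℝ} {κ : ℝ}
    {F : ℕ → ℝ → ℝ} {α : ℕ → ℝ} {Y : ℕ → Ω → ℝ} (hY : ∀ n, Measurable (Y n)) (n : ℕ) :
    Measurable (centredSum a κ F α Y n) := by
  unfold centredSum
  fun_prop

theorem charFun_map_centredSum {Ω : Type*} [MeasurableSpace Ω] {P : Measure Ω}
    [IsProbabilityMeasure P] {U : ℕ → Ω → ℝ} (hU : ∀ n, Measurable (U n)) (hindep : iIndepFun U P)
    (a : ℕ → ℕ → ℝ) (κ : ℝ) (F : ℕ → ℝ → ℝ) (α : ℕ → ℝ) (n : ℕ) (t : ℝ) :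
    charFun (P.map (centredSum a κ F α (fun n ω => (U n ω)⁻¹) n)) t
      = (∏ k ∈ Finset.range n,
          ∫ ω, Complex.exp (-((a k n * -(Complex.I * t)) / U k ω)) ∂P)
        * Complex.exp (-(Complex.I * t) *
          (κ + ∑ k ∈ Finset.range n, a k n * (cConst (F k) (α k) - 1)
            - ∑ k ∈ Finset.range n, α k * a k n * Real.log (a k n) : ℝ)) := by
  set X : ℕ → Ω → ℝ := fun k ω => a k n * (U k ω)⁻¹
  have hX : ∀ k, Measurable (X k) := fun k => (hU k).inv.const_mul _
  have hXi : iIndepFun X P := hindep.comp (fun k x => a k n * x⁻¹) fun k => by fun_prop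
  set d : ℝ := κ + ∑ k ∈ Finset.range n, a k n * (cConst (F k) (α k) - 1)
    - ∑ k ∈ Finset.range n, α k * a k n * Real.log (a k n)
  have e : centredSum a κ F α (fun n ω => (U n ω)⁻¹) n
      = (· + -d) ∘ fun ω => ∑ k ∈ Finset.range n, X k ω := by
    funext ω
    simp only [centredSum, Function.comp, X, d]
    ring
  rw [e, ← Measure.map_map (by fun_prop) (by fun_prop), charFun_map_add_const,
    (hXi.precomp Subtype.val_injective).charFun_map_fun_finsetSum_eq_prod
      fun k _ => (hX k).aemeasurable, Finset.prod_apply]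
  congr 1
  · refine Finset.prod_congr rfl fun k _ => ?_
    rw [charFun_apply_real, integral_map (hX k).aemeasurable (by fun_prop)]
    refine integral_congr_ae (Eventually.of_forall fun ω => ?_)
    simp only [X]
    congr 1
    push_cast
    ring
  · congr 1
    simp
    ring

theorem norm_integral_exp_neg_div_le_one {Ω : Type*} [MeasurableSpace Ω] {P : Measure Ω}
    [IsProbabilityMeasure P] {U : ℕ → Ω → ℝ} {z : ℂ} (hz : z.re = 0) (k : ℕ) :
    ‖∫ ω, Complex.exp (-(z / U k ω)) ∂P‖ ≤ 1 := by
  have := norm_integral_le_of_norm_le_const (μ := P) (C := 1)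
    (f := fun ω => Complex.exp (-(z / U k ω)))
    (Eventually.of_forall fun ω => by rw [norm_exp_neg_div, hz]; simp)
  simpa using this

theorem IsUnitFamily.tendsto_charFun {Ω : Type*} [MeasurableSpace Ω] {P : Measure Ω}
    [IsProbabilityMeasure P] {U : ℕ → Ω → ℝ} {F : ℕ → ℝ → ℝ} {α : ℕ → ℝ}
    (h : IsUnitFamily P U F) (hpos : ∀ n, 0 < α n) (hindep : iIndepFun U P)
    (hii : UniformlyIntegrableAtZero F α) {α₀ : ℝ} (hα : Tendsto α atTop (𝓝 α₀))
    {a : ℕ → ℕ → ℝ} {κ : ℝ} (ha : IsWeightArray a κ) {t : ℝ} (ht : t ≠ 0) :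
    Tendsto (fun n => charFun (P.map (centredSum a κ F α (fun n ω => (U n ω)⁻¹) n)) t) atTop
      (𝓝 (Complex.exp (-(Complex.I * t) * Complex.log (-(Complex.I * t)) * (α₀ * κ : ℝ)))) := by
  obtain ⟨A, -, hA'⟩ := exists_bound_of_tendsto hα
  have hA : ∀ n, α n ≤ A := fun n => (le_abs_self _).trans (hA' n)
  set w : ℂ := -(Complex.I * t) with hw
  have hw0 : w ≠ 0 := by simp [hw, ht]
  have hwn : ‖w‖ = |t| := by simp [hw]
  set ψ : ℕ → ℕ → ℂ := fun k n => ∫ ω, Complex.exp (-((a k n * w) / U k ω)) ∂P with hψ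
  have hre : ∀ k n, ((a k n : ℂ) * w).re = 0 := by simp [hw]
  have hz0 : ∀ k n, k < n → (a k n : ℂ) * w ≠ 0 := fun k n hk =>
    mul_ne_zero (by exact_mod_cast (ha.pos n k hk).ne') hw0
  have hzn : ∀ k n, k < n → ‖(a k n : ℂ) * w‖ = a k n * |t| := fun k n hk => by
    rw [norm_mul, Complex.norm_real, Real.norm_eq_abs, abs_of_pos (ha.pos n k hk), hwn]
  have hψ1 : ∀ k n, ‖ψ k n‖ ≤ 1 := fun k n => norm_integral_exp_neg_div_le_one (hre k n) k
  set err : ℕ → ℕ → ℂ := fun k n =>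
    ψ k n - 1 + a k n * w * (cConst (F k) (α k) - α k * Complex.log (a k n * w)) with herr
  have hsum_err : Tendsto (fun n => ∑ k ∈ Finset.range n, err k n) atTop (𝓝 0) := by
    refine ha.tendsto_sum_zero (abs_pos.2 ht) fun η hη => ?_
    obtain ⟨ρ, hρ, hb⟩ := h.exists_norm_sub_one_add_le_of_re_eq_zero hpos hA hii hη
    refine ⟨ρ, hρ, fun k n hk hlt => ?_⟩
    rw [← hzn k n hk] at hlt ⊢
    exact hb k _ (hre k n) (hz0 k n hk) hlt
  have hsum_diff : Tendsto
      (fun n => ∑ k ∈ Finset.range n, ‖ψ k n - Complex.exp (ψ k n - 1)‖) atTop (𝓝 0) := by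
    refine ha.tendsto_sum_zero (abs_pos.2 ht) fun η hη => ?_
    obtain ⟨ρ, hρ, hb⟩ := h.exists_norm_sub_one_sq_le hpos hA hii hη
    -- The cap `1 / η` forces `‖ψ - 1‖ ≤ 1`, as the Taylor bound requires.
    refine ⟨min ρ (1 / η), by positivity, fun k n hk hlt => ?_⟩
    rw [← hzn k n hk] at hlt ⊢
    have h1 := hb k _ (hre k n) (hz0 k n hk) (hlt.trans_le (min_le_left _ _))
    have h2 : ‖ψ k n - 1‖ ≤ 1 := by
      have h3 := (hlt.trans_le (min_le_right _ _)).le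
      rw [le_div_iff₀ hη, mul_comm] at h3
      exact (sq_le_one_iff₀ (norm_nonneg _)).1 (h1.trans h3)
    rw [norm_norm]
    exact (norm_sub_exp_sub_one_le h2).trans h1
  set d : ℕ → ℝ := fun n => κ + ∑ k ∈ Finset.range n, a k n * (cConst (F k) (α k) - 1)
    - ∑ k ∈ Finset.range n, α k * a k n * Real.log (a k n) with hd
  -- After `log (a w) = log a + log w`, the terms in `c_F` and in `log a` cancel against `w * d n`.
  have hexponent : ∀ n, ∑ k ∈ Finset.range n, (ψ k n - 1) + w * d n
      = ∑ k ∈ Finset.range n, err k n + w * (κ - ∑ k ∈ Finset.range n, a k n : ℝ)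
        + w * Complex.log w * (∑ k ∈ Finset.range n, α k * a k n : ℝ) := by
    intro n
    have hk : ∀ k ∈ Finset.range n, ψ k n - 1 = err k n
        - w * (a k n * (cConst (F k) (α k) - 1) : ℝ) - w * (a k n : ℝ)
        + w * (α k * a k n * Real.log (a k n) : ℝ)
        + w * Complex.log w * (α k * a k n : ℝ) := by
      intro k hk
      simp only [herr]
      rw [Complex.log_ofReal_mul (ha.pos n k (Finset.mem_range.1 hk)) hw0]
      push_cast
      ring
    rw [Finset.sum_congr rfl hk]
    simp only [Finset.sum_add_distrib, Finset.sum_sub_distrib, ← Finset.mul_sum, hd]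
    push_cast
    ring
  have hlim : Tendsto (fun n => Complex.exp (∑ k ∈ Finset.range n, (ψ k n - 1) + w * d n)) atTop
      (𝓝 (Complex.exp (w * Complex.log w * (α₀ * κ : ℝ)))) := by
    simp only [hexponent]
    refine (Complex.continuous_exp.tendsto _).comp ?_
    have h1 := (Complex.continuous_ofReal.tendsto _).comp (ha.tendsto_sum.const_sub κ)
    have h2 := (Complex.continuous_ofReal.tendsto _).comp (ha.tendsto_sum_mul hα)
    have h3 := (hsum_err.add (h1.const_mul w)).add (h2.const_mul (w * Complex.log w))
    simpa [Function.comp_def] using h3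
  -- The factor `exp (w * d n)` has modulus one, however large `d n` is.
  have hdiff : Tendsto (fun n => (∏ k ∈ Finset.range n, ψ k n) * Complex.exp (w * d n)
      - Complex.exp (∑ k ∈ Finset.range n, (ψ k n - 1) + w * d n)) atTop (𝓝 0) := by
    refine squeeze_zero_norm (fun n => ?_) hsum_diff
    rw [Complex.exp_add, ← sub_mul, Complex.exp_sum, norm_mul]
    have h1 : ‖Complex.exp (w * d n)‖ = 1 := by
      rw [Complex.norm_exp]; simp [hw]
    rw [h1, mul_one]
    exact norm_prod_sub_prod_le _ (fun k _ => hψ1 k n)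
      fun k _ => norm_exp_sub_one_le_one (hψ1 k n)
  have := hdiff.add hlim
  rw [zero_add] at this
  refine this.congr fun n => ?_
  rw [charFun_map_centredSum h.measurable hindep, sub_add_cancel]

/-- With the convention `Real.log 0 = 0`, `t log |t|` is continuous through `0`. -/
theorem continuousAt_exp_neg_I_mul_log (c : ℝ) :
    ContinuousAt (fun t : ℝ => Complex.exp (-(Complex.I * ((t * c * Real.log |t| : ℝ) : ℂ))
      - ((Real.pi * c * |t| / 2 : ℝ) : ℂ))) 0 := by
  have : Continuous fun t : ℝ => t * c * Real.log |t| := by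
    have := Real.continuous_mul_log.const_smul c
    refine this.congr fun t => ?_
    rw [Real.log_abs, Pi.smul_apply, smul_eq_mul]
    ring
  fun_prop

theorem mainTheorem4 {Ω : Type*} [MeasurableSpace Ω] (P : Measure Ω) [IsProbabilityMeasure P]
    (U : ℕ → Ω → ℝ) (F : ℕ → StieltjesFunction ℝ) (α : ℕ → ℝ) (α₀ : ℝ)
    (a : ℕ → ℕ → ℝ) (κ : ℝ)
    (hU : ∀ n, Measurable (U n))
    (hindep : iIndepFun U P)
    (hUF : ∀ n, cdf (P.map (U n)) = F n)
    (hF0 : ∀ n, F n 0 = 0)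
    (hF1 : ∀ n, F n 1 = 1)
    (hi : UniformlyLinearAtZero (fun n => F n) α)
    (hii : UniformlyIntegrableAtZero (fun n => F n) α)
    (hα : Tendsto α atTop (𝓝 α₀))
    (ha : IsWeightArray a κ) :
    (∀ n, IntervalIntegrable (bIntegrand (F n) (α n)) volume 0 1) ∧
    ∃ μ : ProbabilityMeasure ℝ,
      (∀ t : ℝ, charFun (μ : Measure ℝ) t =
        Complex.exp (-(Complex.I * ((t * (α₀ * κ) * Real.log |t| : ℝ) : ℂ))
          - ((Real.pi * (α₀ * κ) * |t| / 2 : ℝ) : ℂ))) ∧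
      TendstoInDistribution
        (centredSum a κ (fun n => F n) α (fun n ω => (U n ω)⁻¹))
        atTop (id : ℝ → ℝ) (fun _ => P) (μ : Measure ℝ) := by
  have hF := isUnitFamily_of_cdf P hU hUF hF0 hF1
  obtain ⟨A, -, hA'⟩ := exists_bound_of_tendsto hα
  obtain ⟨M, hM⟩ := exists_abs_bIntegrand_integral_le hF.mono hF.zero hF.one hi.pos
    (fun n => (le_abs_self _).trans (hA' n)) hii
  refine ⟨fun n => (intervalIntegrable_iff_integrableOn_Ioc_of_le zero_le_one).2 (hM n).1, ?_⟩
  have hV := fun n => (measurable_centredSum (a := a) (κ := κ) (F := fun n => F n) (α := α)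
    (Y := fun n ω => (U n ω)⁻¹) (fun n => (hU n).inv) n).aemeasurable (μ := P)
  obtain ⟨μ, hμ, hlim⟩ := exists_probabilityMeasure_of_tendsto_charFun
    (μ := fun n => ⟨P.map (centredSum a κ (fun n => F n) α (fun n ω => (U n ω)⁻¹) n),
      Measure.isProbabilityMeasure_map (hV n)⟩)
    (continuousAt_exp_neg_I_mul_log (α₀ * κ)) (fun t => by
      by_cases ht : t = 0
      · subst ht
        have h1 : ∀ n, IsProbabilityMeasure
            (P.map (centredSum a κ (fun n => F n) α (fun n ω => (U n ω)⁻¹) n)) :=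
          fun n => Measure.isProbabilityMeasure_map (hV n)
        simp
      · have h := hF.tendsto_charFun hi.pos hindep hii hα ha ht
        rw [neg_I_mul_log_neg_I ht] at h
        have e : -(Complex.I * ((t * (α₀ * κ) * Real.log |t| : ℝ) : ℂ))
            - ((Real.pi * (α₀ * κ) * |t| / 2 : ℝ) : ℂ)
            = (-(Complex.I * (t * Real.log |t| : ℝ)) - (Real.pi * |t| / 2 : ℝ)) * (α₀ * κ : ℝ) := by
          simp only [Complex.ofReal_mul, Complex.ofReal_div]
          ring
        rw [e]
        exact h)
  refine ⟨μ, hμ, ⟨hV, aemeasurable_id, ?_⟩⟩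
  have e : (⟨(μ : Measure ℝ).map id, Measure.isProbabilityMeasure_map aemeasurable_id⟩ :
      ProbabilityMeasure ℝ) = μ := Subtype.ext Measure.map_id
  rw [e]
  exact hlim
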